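/- Setting. Let $\|\cdot\|$ be an arbitrary norm on a finite-dimensional real vector space $V$ (i.e. on $\mathbb R^m$), let $\mathbb X\subseteq V$, $\mathbb Y\subseteq\mathbb R$, $\gamma>0$, and equip $\Xi=\mathbb X\times\mathbb Y$ with the metric $d((x,y),(x',y'))=\|x-x'\|+\frac{\gamma}{2}|y-y'|$ and its Borel $\sigma$-algebra. Let $p\ge 1$ and $\sigma>0$ be real. For Borel probability measures $P,Q$ on $\Xi$ let $$W_p(P,Q)=\Big(\inf_{\pi}\int d^p(\xi,\xi')\,\pi(d\xi,d\xi')\Big)^{1/p},$$ the infimum being over all joint distributions $\pi$ with marginals $P$ and $Q$, let $\mathbb B_{\sigma,p}(P)=\{Q: W_p(P,Q)\le\sigma\}$, and for a parameter set $\Theta\subseteq\mathbb R^{k}$ and a loss $\ell$ let $$R^{P}_{\sigma,p}(\theta)=\sup_{Q\in\mathbb B_{\sigma,p}(P)}\mathbb E^{Q}[\ell(\theta,\xi)].$$ Assume that for every $\theta\in\Theta$ the function $\ell(\theta,\cdot):\Xi\to\mathbb R$ is non-negative and continuous, and that there are a point $\xi_0\in\Xi$ and numbers $\mathtt C(\theta)>0$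 such that $\ell(\theta,\xi)\le \mathtt C(\theta)\,(1+d^p(\xi,\xi_0))$ for all $\theta\in\Theta$ and $\xi\in\Xi$. Let $\xi_1,\dots,\xi_n\in\Xi$ and $P_n=\frac1n\sum_{i=1}^n\delta_{\xi_i}$. Put $$h_i(\theta,\lambda)=\sup_{\zeta\in\Xi}\{\ell(\theta,\zeta)-\lambda d^p(\zeta,\xi_i)\}\in[0,\infty],\qquad H(\theta,\lambda)=\frac1n\sum_{i=1}^n h_i(\theta,\lambda),\qquad \rho=\max_{1\le i\le n}d(\xi_i,\xi_0),$$ $$\kappa(\theta)=\limsup_{d(\xi,\xi_0)\to\infty}\frac{\ell(\theta,\xi)-\ell(\theta,\xi_0)}{d^p(\xi,\xi_0)}\quad(\text{and }\kappa(\theta)=0\text{ if }\Xi\text{ is bounded}),\qquad \tau(\theta)=\mathtt C(\theta)\Big(2^{p-1}+\frac{1+2^{p-1}\rho^p}{\sigma^p}\Big).$$ Let $0<\varepsilon<1$; write $a\in(1\pm\varepsilon)b$ for $(1-\varepsilon)b\le a\le(1+\varepsilon)b$, and use the convention $0\cdot\infty=0$. A vector $w=(w_1,\dots,w_n)$ with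 $w_i\ge0$ and $\sum_i w_i=1$ is a dual $\varepsilon$-coreset with query interval $I=[\kappa(\theta),\tau(\theta)]$ if $$\sum_{i=1}^n w_i h_i(\theta,\lambda)\in(1\pm\varepsilon)\,H(\theta,\lambda)\qquad\text{for all }\theta\in\Theta\text{ and all }\lambda\in[\kappa(\theta),\tau(\theta)].$$ Theorem. Every such dual $\varepsilon$-coreset $w$ is an $\varepsilon$-coreset: with $\tilde P_n=\sum_{i=1}^n w_i\delta_{\xi_i}$, $$R^{\tilde P_n}_{\sigma,p}(\theta)\in(1\pm\varepsilon)\,R^{P_n}_{\sigma,p}(\theta)\qquad\text{for all }\theta\in\Theta.$$ -/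

import Mathlib

open MeasureTheory

namespace WDRO

noncomputable section

/-- The feature-label metric `d(ξ, ζ) = ‖x - x'‖ + (γ / 2) |y - y'|` on `Ξ = X × Y`. -/
def featureLabelDist {V : Type*} [NormedAddCommGroup V] (X : Set V) (Y : Set ℝ) (γ : ℝ)
    (ξ ζ : ↥(X ×ˢ Y)) : ℝ :=
  ‖ξ.1.1 - ζ.1.1‖ + γ / 2 * |ξ.1.2 - ζ.1.2|

/-- The joint distributions on `Ξ × Ξ` with marginals `P` and `Q`. -/
def couplings {Ξ : Type*} [MeasurableSpace Ξ] (P Q : Measure Ξ) : Set (Measure (Ξ × Ξ)) :=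
  {π | π.map Prod.fst = P ∧ π.map Prod.snd = Q}

/-- The `p`-th order Wasserstein distance for the ground metric `d`. -/
def wassersteinDist {Ξ : Type*} [MeasurableSpace Ξ] (d : Ξ → Ξ → ℝ) (p : ℝ)
    (P Q : Measure Ξ) : ENNReal :=
  (⨅ π ∈ couplings P Q, ∫⁻ z, ENNReal.ofReal (d z.1 z.2 ^ p) ∂π) ^ (1 / p)

/-- The `p`-th order Wasserstein ball of radius `σ` around `P`. -/
def wassersteinBall {Ξ : Type*} [MeasurableSpace Ξ] (d : Ξ → Ξ → ℝ) (p σ : ℝ)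
    (P : Measure Ξ) : Set (Measure Ξ) :=
  {Q | IsProbabilityMeasure Q ∧ wassersteinDist d p P Q ≤ ENNReal.ofReal σ}

/-- The worst-case risk `sup_{Q ∈ B_{σ,p}(P)} E^Q[f]` of a non-negative loss `f`; the expectation
is the Lebesgue integral of a non-negative function, with values in `[0, ∞]`. -/
def worstCaseRisk {Ξ : Type*} [MeasurableSpace Ξ] (d : Ξ → Ξ → ℝ) (p σ : ℝ)
    (P : Measure Ξ) (f : Ξ → ℝ) : EReal :=
  ⨆ Q ∈ wassersteinBall d p σ P, ((∫⁻ ζ, ENNReal.ofReal (f ζ) ∂Q : ENNReal) : EReal)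

/-- The weighted empirical distribution `∑ i, w i • δ_{ξ i}`. -/
def weightedEmpirical {Ξ : Type*} [MeasurableSpace Ξ] {n : ℕ} (ξ : Fin n → Ξ) (w : Fin n → ℝ) :
    Measure Ξ :=
  ∑ i, ENNReal.ofReal (w i) • Measure.dirac (ξ i)

/-- The uniform mass vector `[1/n, …, 1/n]`, which induces the empirical distribution `P_n`. -/
def uniformMass (n : ℕ) : Fin n → ℝ := fun _ => 1 / n

/-- A mass vector: non-negative entries with total mass one. -/
def IsMassVector {n : ℕ} (w : Fin n → ℝ) : Prop :=
  (∀ i, 0 ≤ w i) ∧ ∑ i, w i = 1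

/-- `a ∈ (1 ± ε) b`. -/
def ApproxWithin (ε : ℝ) (a b : EReal) : Prop :=
  ((1 - ε : ℝ) : EReal) * b ≤ a ∧ a ≤ ((1 + ε : ℝ) : EReal) * b

/-- The Moreau-Yosida regularization `h(lam, ξ) = sup_ζ {f ζ - lam * d(ζ, ξ)^p}`; it may be `+∞`. -/
def moreauYosida {Ξ : Type*} (d : Ξ → Ξ → ℝ) (p : ℝ) (f : Ξ → ℝ) (lam : ℝ) (ξ : Ξ) : EReal :=
  ⨆ ζ, ((f ζ - lam * d ζ ξ ^ p : ℝ) : EReal)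

/-- `∑ i, w i * h(lam, ξ i)`, the expectation of `h(lam, ·)` under the weighted empirical
distribution (with `0 * ∞ = 0`). -/
def dualValue {Ξ : Type*} {n : ℕ} (d : Ξ → Ξ → ℝ) (p : ℝ) (ξ : Fin n → Ξ) (w : Fin n → ℝ)
    (f : Ξ → ℝ) (lam : ℝ) : EReal :=
  ∑ i, (w i : EReal) * moreauYosida d p f lam (ξ i)

/-- An `ε`-coreset for the distributionally robust problem with losses `ℓ θ`, `θ ∈ Θ`. -/
def IsCoreset {Ξ E : Type*} [MeasurableSpace Ξ] {n : ℕ} (d : Ξ → Ξ → ℝ) (p σ : ℝ)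
    (Θ : Set E) (ℓ : E → Ξ → ℝ) (ξ : Fin n → Ξ) (ε : ℝ) (w : Fin n → ℝ) : Prop :=
  IsMassVector w ∧ ∀ θ ∈ Θ,
    ApproxWithin ε (worstCaseRisk d p σ (weightedEmpirical ξ w) (ℓ θ))
      (worstCaseRisk d p σ (weightedEmpirical ξ (uniformMass n)) (ℓ θ))

/-- A dual `ε`-coreset with query region `I θ`, `θ ∈ Θ`. -/
def IsDualCoreset {Ξ E : Type*} {n : ℕ} (d : Ξ → Ξ → ℝ) (p : ℝ)
    (Θ : Set E) (ℓ : E → Ξ → ℝ) (ξ : Fin n → Ξ) (I : E → Set ℝ) (ε : ℝ) (w : Fin n → ℝ) : Prop :=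
  IsMassVector w ∧ ∀ θ ∈ Θ, ∀ lam ∈ I θ,
    ApproxWithin ε (dualValue d p ξ w (ℓ θ) lam) (dualValue d p ξ (uniformMass n) (ℓ θ) lam)

open Classical in
/-- The asymptotic growth rate `κ = limsup_{d(ζ, ξ₀) → ∞} (f ζ - f ξ₀) / d(ζ, ξ₀)^p`, with the usual
convention `κ = 0` on a bounded space. For non-negative `f` with `f ≤ C (1 + d(·, ξ₀)^p)` the
quotient is eventually bounded, so the real-valued `limsup` is the true one. -/
def asymptoticGrowth {Ξ : Type*} (d : Ξ → Ξ → ℝ) (p : ℝ) (ξ₀ : Ξ) (f : Ξ → ℝ) : ℝ :=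
  if BddAbove (Set.range fun ζ => d ζ ξ₀) then 0
  else Filter.limsup (fun ζ => (f ζ - f ξ₀) / d ζ ξ₀ ^ p)
    (Filter.comap (fun ζ => d ζ ξ₀) Filter.atTop)

/-- `ρ = max_i d(ξ i, ξ₀)`. -/
def dataRadius {Ξ : Type*} {n : ℕ} (d : Ξ → Ξ → ℝ) (ξ : Fin n → Ξ) (ξ₀ : Ξ) : ℝ :=
  ⨆ i, d (ξ i) ξ₀

/-- `τ = c (2^(p-1) + (1 + 2^(p-1) ρ^p) / σ^p)`, where `c` is the value of the growth function. -/
def dualBound (p σ ρ c : ℝ) : ℝ :=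
  c * (2 ^ (p - 1) + (1 + 2 ^ (p - 1) * ρ ^ p) / σ ^ p)

end

end WDRO

namespace WDRO

/-- The properties of the ground cost that the duality argument uses. -/
structure IsPseudoDist {Ξ : Type*} (d : Ξ → Ξ → ℝ) : Prop where
  nonneg : ∀ x y, 0 ≤ d x y
  self : ∀ x, d x x = 0
  comm : ∀ x y, d x y = d y x
  triangle : ∀ x y z, d x z ≤ d x y + d y z

/-! ### Ground metric and extended-real sums. -/

theorem isPseudoDist_featureLabelDist {V : Type*} [NormedAddCommGroup V] (X : Set V) (Y : Set ℝ)
    {γ : ℝ} (hγ : 0 < γ) : IsPseudoDist (featureLabelDist X Y γ) where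
  nonneg x y := by unfold featureLabelDist; positivity
  self x := by simp [featureLabelDist]
  comm x y := by simp only [featureLabelDist, norm_sub_rev, abs_sub_comm]
  triangle x y z := by
    have h₁ := norm_sub_le_norm_sub_add_norm_sub x.1.1 y.1.1 z.1.1
    have h₂ := mul_le_mul_of_nonneg_left (abs_sub_le x.1.2 y.1.2 z.1.2) (by positivity : 0 ≤ γ / 2)
    unfold featureLabelDist
    linarith

theorem continuous_featureLabelDist {V : Type*} [NormedAddCommGroup V] (X : Set V) (Y : Set ℝ)
    (γ : ℝ) :
    Continuous fun z : ↥(X ×ˢ Y) × ↥(X ×ˢ Y) => featureLabelDist X Y γ z.1 z.2 := by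
  unfold featureLabelDist
  fun_prop

theorem coe_ennreal_sum {ι : Type*} (s : Finset ι) (f : ι → ENNReal) :
    ((∑ i ∈ s, f i : ENNReal) : EReal) = ∑ i ∈ s, (f i : EReal) := by
  classical
  induction s using Finset.induction_on with
  | empty => simp
  | insert a s ha ih => simp [Finset.sum_insert ha, ih]

theorem coe_real_sum {ι : Type*} (s : Finset ι) (f : ι → ℝ) :
    ((∑ i ∈ s, f i : ℝ) : EReal) = ∑ i ∈ s, (f i : EReal) := by
  classical
  induction s using Finset.induction_on with
  | empty => simp
  | insert a s ha ih => simp [Finset.sum_insert ha, ih]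

/-- A weighted sum of suprema is bounded by any common bound of the weighted sums. -/
theorem sum_mul_iSup_le {Ξ : Type*} [Nonempty Ξ] {n : ℕ} (g : Fin n → Ξ → ℝ) (w : Fin n → ℝ)
    (hw : ∀ i, 0 ≤ w i) (B : ℝ) (h : ∀ ζ : Fin n → Ξ, ∑ i, w i * g i (ζ i) ≤ B) :
    ∑ i, (w i : EReal) * ⨆ ζ, (g i ζ : EReal) ≤ B := by
  classical
  obtain ⟨z₀⟩ := ‹Nonempty Ξ›
  have key : ∀ i, ∃ M : ℝ, (w i : EReal) * ⨆ ζ, (g i ζ : EReal) = (M : EReal) ∧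
      ∀ e > 0, ∃ ζ, M - e ≤ w i * g i ζ := by
    intro i
    rcases (hw i).eq_or_lt with h0 | h0
    · exact ⟨0, by simp [← h0], fun e he => ⟨z₀, by simp [← h0, he.le]⟩⟩
    -- Moving only the `i`-th coordinate away from `z₀` isolates `g i`; this needs `w i > 0`. Terms
    -- of zero weight vanish even if their supremum is infinite.
    have hb : ∀ z, g i z ≤ g i z₀ + (B - ∑ j, w j * g j z₀) / w i := by
      intro z
      have h1 := h fun j => if j = i then z else z₀
      have h2 : ∑ j, w j * g j (if j = i then z else z₀) - ∑ j, w j * g j z₀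
          = w i * g i z - w i * g i z₀ := by
        rw [← Finset.sum_sub_distrib, Finset.sum_eq_single i]
        · simp
        · intro j _ hj; simp [hj]
        · simp
      rw [← sub_le_iff_le_add', le_div_iff₀ h0]
      linarith
    have hS : ∃ S : ℝ, ⨆ ζ, (g i ζ : EReal) = S := by
      have hle : ⨆ ζ, (g i ζ : EReal) ≤ ((g i z₀ + (B - ∑ j, w j * g j z₀) / w i : ℝ) : EReal) :=
        iSup_le fun z => EReal.coe_le_coe_iff.2 (hb z)
      have hge : (g i z₀ : EReal) ≤ ⨆ ζ, (g i ζ : EReal) := le_iSup (fun ζ => (g i ζ : EReal)) z₀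
      refine ⟨(⨆ ζ, (g i ζ : EReal)).toReal, (EReal.coe_toReal ?_ ?_).symm⟩
      · exact (hle.trans_lt (EReal.coe_lt_top _)).ne
      · exact ((EReal.bot_lt_coe _).trans_le hge).ne'
    obtain ⟨S, hS⟩ := hS
    refine ⟨w i * S, by rw [hS, EReal.coe_mul], fun e he => ?_⟩
    have hlt : ((S - e / w i : ℝ) : EReal) < ⨆ ζ, (g i ζ : EReal) := by
      rw [hS, EReal.coe_lt_coe_iff]
      have := div_pos he h0
      linarith
    obtain ⟨ζ, hζ⟩ := lt_iSup_iff.1 hlt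
    refine ⟨ζ, ?_⟩
    have h3 := mul_le_mul_of_nonneg_left (EReal.coe_lt_coe_iff.1 hζ).le h0.le
    have h4 : w i * (S - e / w i) = w i * S - e := by field_simp
    linarith
  choose M hM hζ using key
  rw [Finset.sum_congr rfl fun i _ => hM i, ← coe_real_sum, EReal.coe_le_coe_iff]
  refine le_of_forall_pos_le_add fun e he => ?_
  have hn : (0 : ℝ) < n + 1 := by positivity
  -- The `n` errors of size `e / (n + 1)` add up to at most `e`; the `+ 1` also covers `n = 0`.
  choose ζ hζ using fun i => hζ i (e / (n + 1)) (by positivity)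
  have h5 : ∑ i, (M i - e / (n + 1)) ≤ B := (Finset.sum_le_sum fun i _ => hζ i).trans (h ζ)
  rw [Finset.sum_sub_distrib, Finset.sum_const, Finset.card_univ, Fintype.card_fin,
    nsmul_eq_mul] at h5
  have h6 : (n : ℝ) * (e / (n + 1)) ≤ e := by
    rw [mul_div_assoc', div_le_iff₀ hn]; nlinarith
  linarith

/-! ### Finitely supported measures and feasible transports. -/

section Measures

variable {Ξ : Type*} [MeasurableSpace Ξ] {n : ℕ}

theorem lintegral_weightedEmpirical (ξ : Fin n → Ξ) (w : Fin n → ℝ) {f : Ξ → ENNReal}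
    (hf : Measurable f) :
    ∫⁻ x, f x ∂weightedEmpirical ξ w = ∑ i, ENNReal.ofReal (w i) * f (ξ i) := by
  simp [weightedEmpirical, lintegral_finsetSum_measure, lintegral_smul_measure,
    lintegral_dirac' _ hf]

theorem lintegral_ofReal_weightedEmpirical (ξ : Fin n → Ξ) {w : Fin n → ℝ} (hw : ∀ i, 0 ≤ w i)
    {f : Ξ → ℝ} (hf : Measurable f) (hf₀ : ∀ x, 0 ≤ f x) :
    ∫⁻ x, ENNReal.ofReal (f x) ∂weightedEmpirical ξ w
      = ENNReal.ofReal (∑ i, w i * f (ξ i)) := by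
  rw [lintegral_weightedEmpirical ξ w hf.ennreal_ofReal,
    ENNReal.ofReal_sum_of_nonneg fun i _ => mul_nonneg (hw i) (hf₀ _)]
  exact Finset.sum_congr rfl fun i _ => (ENNReal.ofReal_mul (hw i)).symm

theorem map_weightedEmpirical {Ω : Type*} [MeasurableSpace Ω] (ξ : Fin n → Ξ) (w : Fin n → ℝ)
    {T : Ξ → Ω} (hT : Measurable T) :
    (weightedEmpirical ξ w).map T = weightedEmpirical (fun i => T (ξ i)) w := by
  unfold weightedEmpirical
  rw [Measure.map_finset_sum' hT.aemeasurable]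
  simp [Measure.map_smul, Measure.map_dirac' hT]

theorem isProbabilityMeasure_weightedEmpirical (ξ : Fin n → Ξ) {w : Fin n → ℝ}
    (hw : IsMassVector w) : IsProbabilityMeasure (weightedEmpirical ξ w) := by
  constructor
  have := lintegral_ofReal_weightedEmpirical ξ hw.1 (f := fun _ => 1) measurable_const (by simp)
  simpa [hw.2] using this

/-- Mixtures of two transport maps that respect the average budget lie in the Wasserstein ball,
so their average loss is a lower bound for the worst-case risk. -/
theorem mixture_le_worstCaseRisk {d : Ξ → Ξ → ℝ} (hd₀ : ∀ x y, 0 ≤ d x y)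
    (hdm : Measurable fun z : Ξ × Ξ => d z.1 z.2) {p σ : ℝ} (hp : 1 ≤ p) (hσ : 0 < σ)
    {f : Ξ → ℝ} (hf₀ : ∀ x, 0 ≤ f x) (hf : Measurable f) (ξ ζ₁ ζ₂ : Fin n → Ξ) {w : Fin n → ℝ}
    (hw : IsMassVector w) {s t : ℝ} (hs : 0 ≤ s) (ht : 0 ≤ t) (hst : s + t = 1)
    (hc : s * ∑ i, w i * d (ξ i) (ζ₁ i) ^ p + t * ∑ i, w i * d (ξ i) (ζ₂ i) ^ p ≤ σ ^ p) :
    ((s * ∑ i, w i * f (ζ₁ i) + t * ∑ i, w i * f (ζ₂ i) : ℝ) : EReal)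
      ≤ worstCaseRisk d p σ (weightedEmpirical ξ w) f := by
  have hp0 : 0 < p := by linarith
  have hstE : ENNReal.ofReal s + ENNReal.ofReal t = 1 := by
    rw [← ENNReal.ofReal_add hs ht, hst, ENNReal.ofReal_one]
  set Q : Measure Ξ := ENNReal.ofReal s • weightedEmpirical ζ₁ w
    + ENNReal.ofReal t • weightedEmpirical ζ₂ w with hQ
  set π : Measure (Ξ × Ξ) := ENNReal.ofReal s • weightedEmpirical (fun i => (ξ i, ζ₁ i)) w
    + ENNReal.ofReal t • weightedEmpirical (fun i => (ξ i, ζ₂ i)) w with hπ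
  have int_mix : ∀ {Ω : Type _} [MeasurableSpace Ω] (a b : Fin n → Ω) {g : Ω → ℝ}
      (_ : Measurable g) (_ : ∀ x, 0 ≤ g x),
      ∫⁻ x, ENNReal.ofReal (g x) ∂(ENNReal.ofReal s • weightedEmpirical a w
        + ENNReal.ofReal t • weightedEmpirical b w)
      = ENNReal.ofReal (s * ∑ i, w i * g (a i) + t * ∑ i, w i * g (b i)) := by
    intro Ω _ a b g hg hg₀
    have hnn : ∀ c : Fin n → Ω, 0 ≤ ∑ i, w i * g (c i) := fun c =>
      Finset.sum_nonneg fun i _ => mul_nonneg (hw.1 i) (hg₀ _)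
    rw [lintegral_add_measure, lintegral_smul_measure, lintegral_smul_measure,
      lintegral_ofReal_weightedEmpirical a hw.1 hg hg₀,
      lintegral_ofReal_weightedEmpirical b hw.1 hg hg₀,
      ENNReal.ofReal_add (mul_nonneg hs (hnn a)) (mul_nonneg ht (hnn b)),
      ENNReal.ofReal_mul hs, ENNReal.ofReal_mul ht, smul_eq_mul, smul_eq_mul]
  have hQprob : IsProbabilityMeasure Q := by
    have := isProbabilityMeasure_weightedEmpirical ζ₁ hw
    have := isProbabilityMeasure_weightedEmpirical ζ₂ hw
    exact ⟨by simp [hQ, hstE]⟩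
  have hcoup : π ∈ couplings (weightedEmpirical ξ w) Q := by
    constructor
    · rw [hπ, Measure.map_add _ _ measurable_fst, Measure.map_smul, Measure.map_smul,
        map_weightedEmpirical _ _ measurable_fst, map_weightedEmpirical _ _ measurable_fst,
        ← add_smul, hstE, one_smul]
    · rw [hπ, Measure.map_add _ _ measurable_snd, Measure.map_smul, Measure.map_smul,
        map_weightedEmpirical _ _ measurable_snd, map_weightedEmpirical _ _ measurable_snd]
  have hball : Q ∈ wassersteinBall d p σ (weightedEmpirical ξ w) := by
    refine ⟨hQprob, ?_⟩
    have h1 : ⨅ π ∈ couplings (weightedEmpirical ξ w) Q,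
        ∫⁻ z, ENNReal.ofReal (d z.1 z.2 ^ p) ∂π ≤ ENNReal.ofReal (σ ^ p) := by
      refine (iInf₂_le π hcoup).trans ?_
      rw [hπ, int_mix _ _ (g := fun z : Ξ × Ξ => d z.1 z.2 ^ p) (hdm.pow_const p)
        fun z => Real.rpow_nonneg (hd₀ _ _) _]
      exact ENNReal.ofReal_le_ofReal hc
    calc wassersteinDist d p (weightedEmpirical ξ w) Q
        ≤ ENNReal.ofReal (σ ^ p) ^ (1 / p) := ENNReal.rpow_le_rpow h1 (by positivity)
      _ = ENNReal.ofReal σ := by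
        rw [← ENNReal.ofReal_rpow_of_pos hσ, ← ENNReal.rpow_mul, mul_one_div_cancel hp0.ne',
          ENNReal.rpow_one]
  refine le_trans ?_ (le_iSup₂ (f := fun Q (_ : Q ∈ wassersteinBall d p σ (weightedEmpirical ξ w))
    => ((∫⁻ ζ, ENNReal.ofReal (f ζ) ∂Q : ENNReal) : EReal)) Q hball)
  rw [hQ, int_mix _ _ hf hf₀, EReal.coe_ennreal_ofReal, EReal.coe_le_coe_iff]
  exact le_max_left _ _

end Measures

/-! ### Weak duality. -/

theorem moreauYosida_nonneg {Ξ : Type*} {d : Ξ → Ξ → ℝ} (hd : IsPseudoDist d) {p : ℝ} (hp : 1 ≤ p)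
    {f : Ξ → ℝ} (hf₀ : ∀ x, 0 ≤ f x) (lam : ℝ) (x : Ξ) : 0 ≤ moreauYosida d p f lam x := by
  refine le_trans ?_ (le_iSup (fun ζ => ((f ζ - lam * d ζ x ^ p : ℝ) : EReal)) x)
  rw [hd.self, Real.zero_rpow (by linarith)]
  exact_mod_cast (by simpa using hf₀ x)

/-- Weak duality. -/
theorem worstCaseRisk_le {Ξ : Type*} [MeasurableSpace Ξ] [TopologicalSpace Ξ]
    [BorelSpace Ξ] {n : ℕ} {d : Ξ → Ξ → ℝ} (hd : IsPseudoDist d)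
    (hdc : Continuous fun z : Ξ × Ξ => d z.1 z.2)
    (hdm : Measurable fun z : Ξ × Ξ => d z.1 z.2) {p σ : ℝ} (hp : 1 ≤ p) (hσ : 0 < σ)
    {f : Ξ → ℝ} (hf₀ : ∀ x, 0 ≤ f x) (hf : Measurable f) (ξ : Fin n → Ξ) {w : Fin n → ℝ}
    (hw : ∀ i, 0 ≤ w i) {lam : ℝ} (hlam : 0 ≤ lam) :
    worstCaseRisk d p σ (weightedEmpirical ξ w) f
      ≤ ((lam * σ ^ p : ℝ) : EReal) + dualValue d p ξ w f lam := by
  have hp0 : 0 < p := by linarith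
  set h : Ξ → ENNReal := fun x => ⨆ ζ, ENNReal.ofReal (f ζ - lam * d ζ x ^ p) with hh
  have hmeas : Measurable h := by
    -- The supremum may be uncountable, so measurability comes from lower semicontinuity.
    refine (lowerSemicontinuous_iSup fun ζ => Continuous.lowerSemicontinuous ?_).measurable
    have h1 : Continuous fun x => d ζ x := hdc.comp (Continuous.prodMk_right ζ)
    exact ENNReal.continuous_ofReal.comp
      (continuous_const.sub (continuous_const.mul (h1.rpow_const fun _ => Or.inr hp0.le)))
  have hle : ∀ x, (h x : EReal) ≤ moreauYosida d p f lam x := by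
    intro x
    rw [← EReal.coe_toENNReal (moreauYosida_nonneg hd hp hf₀ lam x),
      EReal.coe_ennreal_le_coe_ennreal_iff]
    refine iSup_le fun ζ => ?_
    rw [← EReal.toReal_coe (f ζ - lam * d ζ x ^ p),
      ← EReal.toENNReal_of_ne_top (EReal.coe_ne_top _)]
    exact EReal.toENNReal_le_toENNReal
      (le_iSup (fun ζ => ((f ζ - lam * d ζ x ^ p : ℝ) : EReal)) ζ)
  have hdual : ((∑ i, ENNReal.ofReal (w i) * h (ξ i) : ENNReal) : EReal)
      ≤ dualValue d p ξ w f lam := by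
    rw [coe_ennreal_sum]
    refine Finset.sum_le_sum fun i _ => ?_
    rw [EReal.coe_ennreal_mul, EReal.coe_ennreal_ofReal, max_eq_left (hw i)]
    exact mul_le_mul_of_nonneg_left (hle _) (EReal.coe_nonneg.2 (hw i))
  refine iSup₂_le fun Q hQ => ?_
  have hinf : ⨅ π ∈ couplings (weightedEmpirical ξ w) Q,
      ∫⁻ z, ENNReal.ofReal (d z.1 z.2 ^ p) ∂π ≤ ENNReal.ofReal (σ ^ p) := by
    have h1 := ENNReal.rpow_le_rpow hQ.2 hp0.le
    unfold wassersteinDist at h1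
    rwa [← ENNReal.rpow_mul, one_div_mul_cancel hp0.ne', ENNReal.rpow_one,
      ENNReal.ofReal_rpow_of_pos hσ] at h1
  have hbound : ∀ π ∈ couplings (weightedEmpirical ξ w) Q,
      ∫⁻ ζ, ENNReal.ofReal (f ζ) ∂Q ≤ ∑ i, ENNReal.ofReal (w i) * h (ξ i)
        + ENNReal.ofReal lam * ∫⁻ z, ENNReal.ofReal (d z.1 z.2 ^ p) ∂π := by
    intro π hπ
    calc ∫⁻ ζ, ENNReal.ofReal (f ζ) ∂Q
        = ∫⁻ z, ENNReal.ofReal (f z.2) ∂π := by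
          rw [← hπ.2, lintegral_map hf.ennreal_ofReal measurable_snd]
      _ ≤ ∫⁻ z, (h z.1 + ENNReal.ofReal lam * ENNReal.ofReal (d z.1 z.2 ^ p)) ∂π := by
          refine lintegral_mono fun z => ?_
          calc ENNReal.ofReal (f z.2)
              = ENNReal.ofReal ((f z.2 - lam * d z.2 z.1 ^ p) + lam * d z.1 z.2 ^ p) := by
                rw [hd.comm z.2 z.1, sub_add_cancel]
            _ ≤ _ := by
                refine ENNReal.ofReal_add_le.trans ?_
                rw [ENNReal.ofReal_mul hlam]
                gcongr
                exact le_iSup (fun ζ => ENNReal.ofReal (f ζ - lam * d ζ z.1 ^ p)) z.2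
      _ = _ := by
          rw [lintegral_add_left (f := fun z : Ξ × Ξ => h z.1) (hmeas.comp measurable_fst),
            lintegral_const_mul _ (hdm.pow_const p).ennreal_ofReal,
            ← lintegral_weightedEmpirical ξ w hmeas, ← hπ.1, lintegral_map hmeas measurable_fst]
  have hfin : ∫⁻ ζ, ENNReal.ofReal (f ζ) ∂Q ≤ ∑ i, ENNReal.ofReal (w i) * h (ξ i)
      + ENNReal.ofReal lam * ENNReal.ofReal (σ ^ p) := by
    refine ENNReal.le_of_forall_pos_le_add fun e he _ => ?_
    -- An optimal coupling need not exist. The slack costs at most `e` after multiplication by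
    -- `lam`, and `lam + 1` allows `lam = 0`.
    have hd0 : 0 < (e : ℝ) / (lam + 1) := by positivity
    have hlt : ⨅ π ∈ couplings (weightedEmpirical ξ w) Q,
        ∫⁻ z, ENNReal.ofReal (d z.1 z.2 ^ p) ∂π < ENNReal.ofReal (σ ^ p + e / (lam + 1)) := by
      refine hinf.trans_lt ((ENNReal.ofReal_lt_ofReal_iff ?_).2 (by linarith))
      have := Real.rpow_pos_of_pos hσ p
      linarith
    obtain ⟨π, hlt⟩ := iInf_lt_iff.1 hlt
    obtain ⟨hπ, hlt⟩ := iInf_lt_iff.1 hlt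
    refine (hbound π hπ).trans ?_
    rw [add_assoc]
    gcongr
    refine (mul_le_mul_right hlt.le _).trans ?_
    rw [ENNReal.ofReal_add (Real.rpow_nonneg hσ.le _) hd0.le, mul_add]
    gcongr
    rw [← ENNReal.ofReal_mul hlam, ← ENNReal.ofReal_coe_nnreal]
    refine ENNReal.ofReal_le_ofReal ?_
    rw [mul_div_assoc', div_le_iff₀ (by linarith)]
    nlinarith [e.coe_nonneg]
  refine (EReal.coe_ennreal_le_coe_ennreal_iff.2 hfin).trans ?_
  rw [EReal.coe_ennreal_add, add_comm, ← ENNReal.ofReal_mul hlam, EReal.coe_ennreal_ofReal,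
    max_eq_left (mul_nonneg hlam (Real.rpow_nonneg hσ.le _))]
  gcongr

/-! ### Strong duality. -/

/-- A supergradient at `c = s` for a set of points `(c, v)`, whose mixtures with `c ≤ s` all have
`v ≤ R`. -/
theorem exists_supergradient {ι : Type*} (c v : ι → ℝ) {s R : ℝ} (i₀ : ι) (hi₀ : c i₀ < s)
    (h : ∀ i j a b, 0 ≤ a → 0 ≤ b → a + b = 1 → a * c i + b * c j ≤ s → a * v i + b * v j ≤ R) :
    ∃ lam, 0 ≤ lam ∧ ∀ i, v i - lam * c i ≤ R - lam * s := by
  have h1 : ∀ i, c i ≤ s → v i ≤ R := fun i hi => by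
    simpa using h i i 1 0 zero_le_one le_rfl (by norm_num) (by simpa using hi)
  have h2 : ∀ i j, c i < s → s < c j → (v j - R) / (c j - s) ≤ (R - v i) / (s - c i) := by
    intro i j hi hj
    have hD : 0 < c j - c i := by linarith
    -- These weights make the mixed cost exactly `s`.
    have h3 := h i j ((c j - s) / (c j - c i)) ((s - c i) / (c j - c i))
      (div_nonneg (by linarith) hD.le) (div_nonneg (by linarith) hD.le)
      (by field_simp; ring) (le_of_eq (by field_simp; ring))
    rw [div_mul_eq_mul_div, div_mul_eq_mul_div, ← add_div, div_le_iff₀ hD] at h3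
    rw [div_le_div_iff₀ (by linarith) (by linarith)]
    linarith
  -- Slopes from `(s, R)` to the points on its right. Adding `0` makes the supremum nonnegative and
  -- `S` nonempty; `i₀` supplies an upper bound.
  set S : Set ℝ := insert 0 ((fun j => (v j - R) / (c j - s)) '' {j | s < c j}) with hS
  have hub : ∀ i, c i < s → (R - v i) / (s - c i) ∈ upperBounds S := by
    rintro i hi x (rfl | ⟨j, hj, rfl⟩)
    · exact div_nonneg (by linarith [h1 i hi.le]) (by linarith)
    · exact h2 i j hi hj
  have hbdd : BddAbove S := ⟨_, hub i₀ hi₀⟩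
  refine ⟨sSup S, le_csSup hbdd (Set.mem_insert _ _), fun i => ?_⟩
  rcases lt_trichotomy (c i) s with hi | hi | hi
  · have h4 := csSup_le ⟨0, Set.mem_insert _ _⟩ (hub i hi)
    rw [le_div_iff₀ (by linarith)] at h4
    linarith
  · rw [hi]; linarith [h1 i hi.le]
  · have h4 : (v i - R) / (c i - s) ≤ sSup S :=
      le_csSup hbdd (Set.mem_insert_of_mem _ ⟨i, hi, rfl⟩)
    rw [div_le_iff₀ (by linarith)] at h4
    linarith

/-- The dual problem has a solution whenever the worst-case risk is finite. -/
theorem exists_dual_le {Ξ : Type*} [MeasurableSpace Ξ] {n : ℕ} {d : Ξ → Ξ → ℝ}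
    (hd : IsPseudoDist d) (hdm : Measurable fun z : Ξ × Ξ => d z.1 z.2) {p σ : ℝ}
    (hp : 1 ≤ p) (hσ : 0 < σ) {f : Ξ → ℝ} (hf₀ : ∀ x, 0 ≤ f x) (hf : Measurable f) [Nonempty Ξ]
    (ξ : Fin n → Ξ) {w : Fin n → ℝ} (hw : IsMassVector w) {R : ℝ}
    (hR : worstCaseRisk d p σ (weightedEmpirical ξ w) f = R) :
    ∃ lam, 0 ≤ lam ∧ dualValue d p ξ w f lam ≤ ((R - lam * σ ^ p : ℝ) : EReal) := by
  have hp0 : 0 < p := by linarith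
  obtain ⟨lam, hlam, h⟩ := exists_supergradient (ι := Fin n → Ξ)
    -- The identity transport `ξ` has cost zero, strictly below the budget: this is the Slater
    -- point.
    (fun ζ => ∑ i, w i * d (ξ i) (ζ i) ^ p) (fun ζ => ∑ i, w i * f (ζ i)) (s := σ ^ p) (R := R) ξ
    (by simpa [hd.self, Real.zero_rpow hp0.ne'] using Real.rpow_pos_of_pos hσ p)
    (fun ζ₁ ζ₂ a b ha hb hab hc => by
      have := mixture_le_worstCaseRisk hd.nonneg hdm hp hσ hf₀ hf ξ ζ₁ ζ₂ hw ha hb hab hc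
      rwa [hR, EReal.coe_le_coe_iff] at this)
  refine ⟨lam, hlam, sum_mul_iSup_le (fun i ζ => f ζ - lam * d ζ (ξ i) ^ p) w hw.1 _ fun ζ => ?_⟩
  refine le_trans (le_of_eq ?_) (h ζ)
  rw [Finset.mul_sum, ← Finset.sum_sub_distrib]
  refine Finset.sum_congr rfl fun i _ => ?_
  rw [hd.comm (ζ i)]
  ring

/-! ### Localization of the multiplier in `[κ, τ]`. -/

open Filter Topology in
/-- A multiplier with finite Moreau-Yosida regularization dominates the asymptotic growth rate. -/
theorem asymptoticGrowth_le {Ξ : Type*} {d : Ξ → Ξ → ℝ} (hd : IsPseudoDist d) {p : ℝ} (hp : 1 ≤ p)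
    {f : Ξ → ℝ} (hf₀ : ∀ x, 0 ≤ f x) (ξ₀ x : Ξ) {lam M : ℝ} (hlam : 0 ≤ lam)
    (h : ∀ ζ, f ζ - lam * d ζ x ^ p ≤ M) : asymptoticGrowth d p ξ₀ f ≤ lam := by
  unfold asymptoticGrowth
  split_ifs with hb
  · exact hlam
  have hp0 : 0 < p := by linarith
  set F := comap (fun ζ => d ζ ξ₀) atTop with hF
  have hT : Tendsto (fun ζ => d ζ ξ₀) F atTop := tendsto_comap
  have hne : F.NeBot := by
    refine comap_neBot_iff.2 fun t ht => ?_
    obtain ⟨a, ha⟩ := mem_atTop_sets.1 ht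
    rw [not_bddAbove_iff] at hb
    obtain ⟨_, ⟨ζ, rfl⟩, hζ⟩ := hb a
    exact ⟨ζ, ha _ hζ.le⟩
  set A := d ξ₀ x with hA
  have hinv : Tendsto (fun t : ℝ => (t ^ p)⁻¹) atTop (𝓝 0) :=
    (tendsto_rpow_atTop hp0).inv_tendsto_atTop
  have hφ : Tendsto (fun t : ℝ => |M| * (t ^ p)⁻¹ + lam * (1 + A * t⁻¹) ^ p) atTop (𝓝 lam) := by
    have h1 : Tendsto (fun t : ℝ => (1 + A * t⁻¹) ^ p) atTop (𝓝 ((1 + A * 0) ^ p)) :=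
      ((tendsto_inv_atTop_zero.const_mul A).const_add 1).rpow_const (Or.inr hp0.le)
    simpa using (hinv.const_mul |M|).add (h1.const_mul lam)
  have hupper : ∀ᶠ ζ in F, (f ζ - f ξ₀) / d ζ ξ₀ ^ p
      ≤ |M| * (d ζ ξ₀ ^ p)⁻¹ + lam * (1 + A * (d ζ ξ₀)⁻¹) ^ p := by
    filter_upwards [hT.eventually_gt_atTop 0] with ζ hζ
    have hpos := Real.rpow_pos_of_pos hζ p
    have hA0 : 0 ≤ A := hd.nonneg _ _
    have h1 : d ζ x ^ p ≤ (1 + A * (d ζ ξ₀)⁻¹) ^ p * d ζ ξ₀ ^ p := by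
      rw [← Real.mul_rpow (by positivity) hζ.le]
      refine Real.rpow_le_rpow (hd.nonneg _ _) ((hd.triangle ζ ξ₀ x).trans (le_of_eq ?_)) hp0.le
      rw [← hA]
      field_simp
    rw [div_le_iff₀ hpos, add_mul, mul_assoc, inv_mul_cancel₀ hpos.ne', mul_one, mul_assoc]
    have h2 := mul_le_mul_of_nonneg_left h1 hlam
    linarith [h ζ, hf₀ ξ₀, le_abs_self M]
  -- A real `limsup` obeys an eventual upper bound only if the quotient does not tend to `-∞`;
  -- nonnegativity of `f` rules this out.
  have hlower : ∀ᶠ ζ in F, -1 ≤ (f ζ - f ξ₀) / d ζ ξ₀ ^ p := by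
    filter_upwards [((tendsto_rpow_atTop hp0).comp hT).eventually_ge_atTop (f ξ₀ + 1)] with ζ hζ
    have hζ' : f ξ₀ + 1 ≤ d ζ ξ₀ ^ p := hζ
    rw [le_div_iff₀ (by linarith [hf₀ ξ₀])]
    linarith [hf₀ ζ]
  refine le_of_forall_pos_le_add fun e he => limsup_le_of_le
    (isCoboundedUnder_le_of_eventually_le F hlower) ?_
  filter_upwards [hupper, (hφ.comp hT).eventually_le_const (by linarith : lam < lam + e)]
    with ζ h1 h2 using h1.trans h2

/-- Convexity of `t ↦ t ^ p`; the source of the factor `2 ^ (p - 1)` in `τ`. -/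
theorem add_rpow_le_two_rpow_mul {a b p : ℝ} (ha : 0 ≤ a) (hb : 0 ≤ b) (hp : 1 ≤ p) :
    (a + b) ^ p ≤ 2 ^ (p - 1) * (a ^ p + b ^ p) := by
  lift a to NNReal using ha
  lift b to NNReal using hb
  exact_mod_cast NNReal.rpow_add_le_mul_rpow_add_rpow a b hp

theorem dualValue_le {Ξ : Type*} {n : ℕ} [Nonempty Ξ] {d : Ξ → Ξ → ℝ} {p : ℝ} {f : Ξ → ℝ}
    (ξ : Fin n → Ξ) {w : Fin n → ℝ} (hw : IsMassVector w) {lam B : ℝ}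
    (h : ∀ i ζ, f ζ - lam * d ζ (ξ i) ^ p ≤ B) : dualValue d p ξ w f lam ≤ B := by
  refine sum_mul_iSup_le (fun i ζ => f ζ - lam * d ζ (ξ i) ^ p) w hw.1 B fun ζ => ?_
  calc ∑ i, w i * (f (ζ i) - lam * d (ζ i) (ξ i) ^ p) ≤ ∑ i, w i * B :=
        Finset.sum_le_sum fun i _ => mul_le_mul_of_nonneg_left (h i _) (hw.1 i)
    _ = B := by rw [← Finset.sum_mul, hw.2, one_mul]

theorem dualValue_nonneg {Ξ : Type*} {n : ℕ} {d : Ξ → Ξ → ℝ} (hd : IsPseudoDist d) {p : ℝ}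
    (hp : 1 ≤ p) {f : Ξ → ℝ} (hf₀ : ∀ x, 0 ≤ f x) (ξ : Fin n → Ξ) {w : Fin n → ℝ}
    (hw : ∀ i, 0 ≤ w i) (lam : ℝ) : 0 ≤ dualValue d p ξ w f lam :=
  Finset.sum_nonneg fun i _ =>
    mul_nonneg (EReal.coe_nonneg.2 (hw i)) (moreauYosida_nonneg hd hp hf₀ lam _)

/-- A finite dual value bounds the regularization at some data point. -/
theorem exists_bound_of_dualValue_le {Ξ : Type*} {n : ℕ} {d : Ξ → Ξ → ℝ} (hd : IsPseudoDist d)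
    {p : ℝ} (hp : 1 ≤ p) {f : Ξ → ℝ} (hf₀ : ∀ x, 0 ≤ f x) (ξ : Fin n → Ξ) {w : Fin n → ℝ}
    (hw : IsMassVector w) {lam B : ℝ} (h : dualValue d p ξ w f lam ≤ B) :
    ∃ i M, ∀ ζ, f ζ - lam * d ζ (ξ i) ^ p ≤ M := by
  obtain ⟨i, -, hi⟩ : ∃ i ∈ Finset.univ, 0 < w i := by
    by_contra! hcon
    linarith [hw.2, Finset.sum_nonpos hcon]
  refine ⟨i, B / w i, fun ζ => ?_⟩
  rw [le_div_iff₀ hi, mul_comm, ← EReal.coe_le_coe_iff, EReal.coe_mul]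
  refine le_trans ?_ h
  refine le_trans ?_ (Finset.single_le_sum
    (f := fun i => (w i : EReal) * moreauYosida d p f lam (ξ i))
    (fun j _ => mul_nonneg (EReal.coe_nonneg.2 (hw.1 j)) (moreauYosida_nonneg hd hp hf₀ lam _))
    (Finset.mem_univ i))
  exact mul_le_mul_of_nonneg_left
    (le_iSup (fun ζ => ((f ζ - lam * d ζ (ξ i) ^ p : ℝ) : EReal)) ζ) (EReal.coe_nonneg.2 hi.le)

/-- Strong duality with a multiplier in the interval `[κ, τ]`. -/
theorem exists_multiplier {Ξ : Type*} [MeasurableSpace Ξ] {n : ℕ} {d : Ξ → Ξ → ℝ}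
    (hd : IsPseudoDist d) (hdm : Measurable fun z : Ξ × Ξ => d z.1 z.2) {p σ : ℝ}
    (hp : 1 ≤ p) (hσ : 0 < σ) {f : Ξ → ℝ} (hf₀ : ∀ x, 0 ≤ f x) (hf : Measurable f) (ξ₀ : Ξ)
    {c : ℝ} (hc : 0 < c) (hgrowth : ∀ ζ, f ζ ≤ c * (1 + d ζ ξ₀ ^ p))
    (ξ : Fin n → Ξ) {w : Fin n → ℝ} (hw : IsMassVector w) :
    ∃ lam ∈ Set.Icc (asymptoticGrowth d p ξ₀ f) (dualBound p σ (dataRadius d ξ ξ₀) c), 0 ≤ lam ∧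
      ((lam * σ ^ p : ℝ) : EReal) + dualValue d p ξ w f lam
        ≤ worstCaseRisk d p σ (weightedEmpirical ξ w) f := by
  have : Nonempty Ξ := ⟨ξ₀⟩
  have hp0 : 0 < p := by linarith
  set ρ := dataRadius d ξ ξ₀ with hρ
  set K : ℝ := 2 ^ (p - 1) with hK
  have hK0 : 0 < K := Real.rpow_pos_of_pos two_pos _
  have hs : 0 < σ ^ p := Real.rpow_pos_of_pos hσ p
  have hdρ : ∀ i, d (ξ i) ξ₀ ≤ ρ := fun i =>
    le_ciSup (f := fun i => d (ξ i) ξ₀) (Set.finite_range _).bddAbove i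
  have hi : ∃ i : Fin n, True := by
    by_contra hcon
    have : IsEmpty (Fin n) := ⟨fun i => hcon ⟨i, trivial⟩⟩
    simpa using hw.2
  obtain ⟨i₁, -⟩ := hi
  have hρ0 : 0 ≤ ρ := (hd.nonneg _ _).trans (hdρ i₁)
  have hτ : dualBound p σ ρ c * σ ^ p = c * K * σ ^ p + c * (1 + K * ρ ^ p) := by
    rw [dualBound, ← hK]
    field_simp
  -- Moving the growth bound from `ξ₀` to `ξ i` shows that `c * K` is a multiplier with finite
  -- regularizations. The definition of `τ` makes `τ * σ ^ p` the resulting bound on its dual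
  -- objective.
  have hbound : ∀ i ζ, f ζ - c * K * d ζ (ξ i) ^ p ≤ c * (1 + K * ρ ^ p) := by
    intro i ζ
    have h1 : d ζ ξ₀ ^ p ≤ K * (d ζ (ξ i) ^ p + ρ ^ p) :=
      (Real.rpow_le_rpow (hd.nonneg _ _)
        ((hd.triangle ζ (ξ i) ξ₀).trans (add_le_add_right (hdρ i) _)) hp0.le).trans
        (add_rpow_le_two_rpow_mul (hd.nonneg _ _) hρ0 hp)
    have h2 := mul_le_mul_of_nonneg_left h1 hc.le
    linarith [hgrowth ζ]
  have hcK : 0 ≤ c * K := by positivity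
  have hmem : c * K ∈ Set.Icc (asymptoticGrowth d p ξ₀ f) (dualBound p σ ρ c) := by
    refine ⟨asymptoticGrowth_le hd hp hf₀ ξ₀ (ξ i₁) hcK (hbound i₁), ?_⟩
    refine le_of_mul_le_mul_right ?_ hs
    rw [hτ]
    have : 0 ≤ c * (1 + K * ρ ^ p) := by positivity
    linarith
  have hval : ((c * K * σ ^ p : ℝ) : EReal) + dualValue d p ξ w f (c * K)
      ≤ ((dualBound p σ ρ c * σ ^ p : ℝ) : EReal) := by
    rw [hτ, EReal.coe_add]
    exact add_le_add_right (dualValue_le ξ hw hbound) _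
  by_cases htop : worstCaseRisk d p σ (weightedEmpirical ξ w) f = ⊤
  · exact ⟨c * K, hmem, hcK, htop ▸ le_top⟩
  have hbot : worstCaseRisk d p σ (weightedEmpirical ξ w) f ≠ ⊥ := by
    have h1 := mixture_le_worstCaseRisk hd.nonneg hdm hp hσ hf₀ hf ξ ξ ξ hw zero_le_one le_rfl
      (add_zero 1) (by simpa [hd.self, Real.zero_rpow hp0.ne'] using hs.le)
    exact ((EReal.bot_lt_coe _).trans_le h1).ne'
  obtain ⟨R, hR⟩ : ∃ R : ℝ, worstCaseRisk d p σ (weightedEmpirical ξ w) f = R :=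
    ⟨_, (EReal.coe_toReal htop hbot).symm⟩
  obtain ⟨lam, hlam, h⟩ := exists_dual_le hd hdm hp hσ hf₀ hf ξ hw hR
  have hRle : ((lam * σ ^ p : ℝ) : EReal) + dualValue d p ξ w f lam ≤ R := by
    refine (add_le_add_right h _).trans ?_
    rw [← EReal.coe_add, add_sub_cancel]
  rw [hR]
  obtain ⟨i, M, hM⟩ := exists_bound_of_dualValue_le hd hp hf₀ ξ hw h
  rcases le_total lam (dualBound p σ ρ c) with hle | hle
  · exact ⟨lam, ⟨asymptoticGrowth_le hd hp hf₀ ξ₀ (ξ i) hlam hM, hle⟩, hlam, hRle⟩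
  -- Past `τ`, the objective at `lam` is at least `τ * σ ^ p`, so `c * K` does no worse.
  · refine ⟨c * K, hmem, hcK, hval.trans (le_trans ?_ hRle)⟩
    refine (EReal.coe_le_coe_iff.2 (mul_le_mul_of_nonneg_right hle hs.le)).trans ?_
    exact le_add_of_nonneg_right (dualValue_nonneg hd hp hf₀ ξ hw.1 lam)

/-! ### Transfer from the dual to the primal. -/

theorem coe_mul_coe_add {a b : ℝ} (ha : 0 ≤ a) (x : EReal) :
    (a : EReal) * ((b : EReal) + x) = ((a * b : ℝ) : EReal) + a * x := by
  rw [EReal.left_distrib_of_nonneg_of_ne_top (EReal.coe_nonneg.2 ha) (EReal.coe_ne_top a),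
    EReal.coe_mul]

theorem isMassVector_uniformMass {n : ℕ} (hn : n ≠ 0) : IsMassVector (uniformMass n) := by
  refine ⟨fun i => by unfold uniformMass; positivity, ?_⟩
  simp [uniformMass, hn]

end WDRO

theorem theorem1 {V : Type*} [NormedAddCommGroup V] [NormedSpace ℝ V] [FiniteDimensional ℝ V]
    [MeasurableSpace V] [BorelSpace V]
    (X : Set V) (Y : Set ℝ) (γ : ℝ) (hγ : 0 < γ)
    (p σ : ℝ) (hp : 1 ≤ p) (hσ : 0 < σ)
    {m n : ℕ} (Θ : Set (EuclideanSpace ℝ (Fin m)))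
    (ℓ : EuclideanSpace ℝ (Fin m) → ↥(X ×ˢ Y) → ℝ)
    (hℓ_nonneg : ∀ θ ∈ Θ, ∀ ζ, 0 ≤ ℓ θ ζ)
    (hℓ_cont : ∀ θ ∈ Θ, Continuous (ℓ θ))
    (C : EuclideanSpace ℝ (Fin m) → ℝ) (hC_pos : ∀ θ ∈ Θ, 0 < C θ)
    (ξ₀ : ↥(X ×ˢ Y))
    (hgrowth : ∀ θ ∈ Θ, ∀ ζ, ℓ θ ζ ≤ C θ * (1 + WDRO.featureLabelDist X Y γ ζ ξ₀ ^ p))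
    (ξ : Fin n → ↥(X ×ˢ Y))
    (ε : ℝ) (hε_pos : 0 < ε) (hε_lt : ε < 1)
    (w : Fin n → ℝ)
    (hw : WDRO.IsDualCoreset (WDRO.featureLabelDist X Y γ) p Θ ℓ ξ
      (fun θ => Set.Icc
        (WDRO.asymptoticGrowth (WDRO.featureLabelDist X Y γ) p ξ₀ (ℓ θ))
        (WDRO.dualBound p σ (WDRO.dataRadius (WDRO.featureLabelDist X Y γ) ξ ξ₀) (C θ)))
      ε w) :
    WDRO.IsCoreset (WDRO.featureLabelDist X Y γ) p σ Θ ℓ ξ ε w := by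
  -- Properness gives second countability, so the continuous metric is measurable for the product
  -- σ-algebra.
  have : ProperSpace V := FiniteDimensional.proper_real V
  have hd := WDRO.isPseudoDist_featureLabelDist X Y hγ
  have hdc := WDRO.continuous_featureLabelDist X Y γ
  have hdm := hdc.measurable
  have hn : n ≠ 0 := by
    rintro rfl
    simpa using hw.1.2
  have hu := WDRO.isMassVector_uniformMass hn
  refine ⟨hw.1, fun θ hθ => ⟨?_, ?_⟩⟩
  · obtain ⟨lam, hmem, hlam, h⟩ := WDRO.exists_multiplier hd hdm hp hσ (hℓ_nonneg θ hθ)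
      (hℓ_cont θ hθ).measurable ξ₀ (hC_pos θ hθ) (hgrowth θ hθ) ξ hw.1
    refine le_trans ?_ h
    have h1 : 0 ≤ 1 - ε := by linarith
    refine (mul_le_mul_of_nonneg_left (WDRO.worstCaseRisk_le hd hdc hdm hp hσ (hℓ_nonneg θ hθ)
      (hℓ_cont θ hθ).measurable ξ hu.1 hlam) (EReal.coe_nonneg.2 h1)).trans ?_
    rw [WDRO.coe_mul_coe_add h1]
    refine add_le_add (EReal.coe_le_coe_iff.2 ?_) (hw.2 θ hθ lam hmem).1
    have : 0 ≤ lam * σ ^ p := by positivity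
    nlinarith
  · obtain ⟨lam, hmem, hlam, h⟩ := WDRO.exists_multiplier hd hdm hp hσ (hℓ_nonneg θ hθ)
      (hℓ_cont θ hθ).measurable ξ₀ (hC_pos θ hθ) (hgrowth θ hθ) ξ hu
    have h1 : 0 ≤ 1 + ε := by linarith
    refine le_trans ?_ (mul_le_mul_of_nonneg_left h (EReal.coe_nonneg.2 h1))
    refine (WDRO.worstCaseRisk_le hd hdc hdm hp hσ (hℓ_nonneg θ hθ)
      (hℓ_cont θ hθ).measurable ξ hw.1.1 hlam).trans ?_
    rw [WDRO.coe_mul_coe_add h1]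
    refine add_le_add (EReal.coe_le_coe_iff.2 ?_) (hw.2 θ hθ lam hmem).2
    have : 0 ≤ lam * σ ^ p := by positivity
    nlinarith
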